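/- **Theorem 5.2.** Let $\mathcal X$ be a finite set, let $G$ be a finite commutative group (written additively), put $M=|\mathcal X|$ and $N=|G|$, and let $q<k\le M$ be non-negative integers. In the oracle interrogation problem a function $A:\mathcal X\to G$ is drawn uniformly at random, and an algorithm that may make $q$ quantum queries to $A$ has to output $k$ pairs $(x_1,y_1),\dots,(x_k,y_k)\in\mathcal X\times G$; it succeeds if the $x_i$ are pairwise distinct and $A(x_i)=y_i$ for all $i$. A $q$-query quantum algorithm has a register with basis states $|x,r,z\rangle$, where $z$ ranges over a workspace of arbitrary finite size; it starts in a unit vector not depending on $A$, makes $q$ queries, applies after each query a unitary not depending on $A$, and at the end measures in the standard basis, its output being a function of the outcome. A query is either the controlled-add operator $|x,g,z\rangle\mapsto|x,g+A(x),z\rangle$ ($g\in G$), or the phase operator $|x,\xi,z\rangle\mapsto\xi(A(x))\,|x,\xi,z\rangle$ ($\xi$ a character of $G$). In each of these two query models, the maximum, over all $q$-query quantum algorithms, of the success probability (over the random choice of $A$ and the final measurement) is attained and equals exactly $$\frac1{N^k}\sum_{i=0}^{q}\binom{k}{i}(N-1)^i .$$ -/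

import Mathlib

open scoped BigOperators Matrix

/-- A quantum algorithm making `q` oracle queries with outcomes in `Y`. The basis states of its
register are `|x, r, z⟩` with `x : X` the query input, `r : R` the response register, and `z` a
workspace of arbitrary finite dimension. It starts in a unit vector `init` independent of the
oracle, applies the unitary `step i` right after the `i`-th query, and finally measures all
registers in the standard basis, reading its output off the measured basis state. -/
structure QueryAlgorithm (X R Y : Type*) [Fintype X] [DecidableEq X] [Fintype R] [DecidableEq R]
    (q : ℕ) where
  /-- dimension of the workspace -/
  w : ℕ
  /-- amplitudes of the initial state -/
  init : X × R × Fin w → ℂ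
  init_unit : ∑ b, ‖init b‖ ^ 2 = 1
  /-- the oracle-independent unitary applied after each query -/
  step : Fin q → Matrix.unitaryGroup (X × R × Fin w) ℂ
  /-- the classical output attached to each measurement outcome -/
  out : X × R × Fin w → Y

/-- Alternately apply the query operator `O` and the unitaries `U 0, …, U (q - 1)` to `v`. -/
noncomputable def runQueries {B : Type*} [Fintype B] [DecidableEq B] (O : Matrix B B ℂ) :
    {q : ℕ} → (Fin q → Matrix.unitaryGroup B ℂ) → (B → ℂ) → (B → ℂ)
  | 0, _, v => v
  | q + 1, U, v =>
      (U (Fin.last q) : Matrix B B ℂ) *ᵥ (O *ᵥ runQueries O (fun i : Fin q => U i.castSucc) v)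

/-- The controlled-add query `|x, g, z⟩ ↦ |x, g + A x, z⟩`. -/
def addQuery {X G : Type*} [DecidableEq X] [AddCommGroup G] [DecidableEq G] (w : ℕ) (A : X → G) :
    Matrix (X × G × Fin w) (X × G × Fin w) ℂ :=
  Matrix.of fun b' b => if b' = (b.1, b.2.1 + A b.1, b.2.2) then 1 else 0

/-- The phase query `|x, ξ, z⟩ ↦ ξ (A x) |x, ξ, z⟩`, where `ξ` is a character of `G`. -/
noncomputable def phaseQuery {X G : Type*} [DecidableEq X] [AddCommGroup G] (w : ℕ) (A : X → G) :
    Matrix (X × AddChar G ℂ × Fin w) (X × AddChar G ℂ × Fin w) ℂ :=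
  Matrix.diagonal fun b => b.2.1 (A b.1)

/-- The list `y` consists of `k` input/output pairs of `A` with pairwise distinct inputs. -/
def IsInterrogation {X G : Type*} {k : ℕ} (A : X → G) (y : Fin k → X × G) : Prop :=
  Function.Injective (fun i => (y i).1) ∧ ∀ i, A (y i).1 = (y i).2

open Classical in
/-- The probability that `alg`, querying a fixed oracle `A` through the query operators `query`,
outputs `k` correct input/output pairs of `A` with distinct inputs. -/
noncomputable def successProbOn {X R G : Type*} [Fintype X] [DecidableEq X] [Fintype R]
    [DecidableEq R] {q k : ℕ}
    (query : (w : ℕ) → (X → G) → Matrix (X × R × Fin w) (X × R × Fin w) ℂ)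
    (alg : QueryAlgorithm X R (Fin k → X × G) q) (A : X → G) : ℝ :=
  ∑ b, if IsInterrogation A (alg.out b) then
    ‖runQueries (query alg.w A) alg.step alg.init b‖ ^ 2 else 0

/-- The success probability of `alg` in oracle interrogation, over a uniformly random oracle
`A : X → G` and the measurement of the algorithm. -/
noncomputable def successProb {X R G : Type*} [Fintype X] [DecidableEq X] [Fintype R]
    [DecidableEq R] [Fintype G] {q k : ℕ}
    (query : (w : ℕ) → (X → G) → Matrix (X × R × Fin w) (X × R × Fin w) ℂ)
    (alg : QueryAlgorithm X R (Fin k → X × G) q) : ℝ :=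
  (∑ A : X → G, successProbOn query alg A) / (Fintype.card (X → G) : ℝ)

/-!
Up to a Fourier transform of the response register, which does not depend on the oracle, a
controlled-add query is a phase query, and a phase query multiplies each amplitude by a character of
one value of `A`. After `q` queries the amplitudes are therefore functions of `A` of degree at most
`q`: linear combinations of products of characters of at most `q` values of `A`.

Fix `k` inputs and let only their values vary, over `G ^ k`. By Parseval and Cauchy-Schwarz, a
function spanned by `m` characters of `G ^ k` carries at most the proportion `m / N ^ k` of its
squared norm at any single point. An output is correct on a single point of `G ^ k`, so `m / N ^ k`,
with `m` the number of characters of degree at most `q`, bounds the success probability.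

Conversely, the uniform superposition over these `m` characters can be multiplied by their values at
`A` with `q` phase queries, the inputs queried being controlled by the workspace. An inverse Fourier
transform then yields the values of `A` at `k` fixed inputs with probability exactly `m / N ^ k`.
-/

open Function
open scoped Finset Kronecker

section Hamming

variable {ι α : Type*} [Fintype ι]

lemma hammingNorm_add_le {α : ι → Type*} [∀ i, AddGroup (α i)] [∀ i, DecidableEq (α i)]
    (c d : ∀ i, α i) : hammingNorm (c + d) ≤ hammingNorm c + hammingNorm d := by
  simpa only [hammingDist_zero_left, hammingDist_eq_hammingNorm c, neg_add_cancel_left] using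
    hammingDist_triangle 0 c (c + d)

lemma hammingNorm_single_le [DecidableEq ι] {α : ι → Type*} [∀ i, Zero (α i)]
    [∀ i, DecidableEq (α i)] (i : ι) (a : α i) : hammingNorm (Pi.single i a) ≤ 1 := by
  refine (Finset.card_le_card fun j hj => ?_).trans (Finset.card_singleton i).le
  by_contra h
  simp_all

lemma exists_hammingNorm_update_zero_le [DecidableEq ι] [Nonempty ι] {α : ι → Type*}
    [∀ i, Zero (α i)] [∀ i, DecidableEq (α i)] (c : ∀ i, α i) :
    ∃ i, hammingNorm (update c i 0) ≤ hammingNorm c - 1 := by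
  rcases eq_or_ne c 0 with rfl | hc
  · exact ⟨Classical.arbitrary ι, by simp [update_eq_self_iff.2]⟩
  · obtain ⟨i, hi⟩ := ne_iff.1 hc
    refine ⟨i, ?_⟩
    have hmem : i ∈ ({j | c j ≠ 0} : Finset ι) := by simpa using hi
    rw [hammingNorm, hammingNorm, ← Finset.card_erase_of_mem hmem]
    refine Finset.card_le_card fun j hj => ?_
    rcases eq_or_ne j i with rfl | hji <;> simp_all

variable [DecidableEq α] [Zero α]

lemma hammingNorm_comp_le {κ : Type*} [Fintype κ] {x : κ → ι} (hx : Injective x) (c : ι → α) :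
    hammingNorm (c ∘ x) ≤ hammingNorm c :=
  Finset.card_le_card_of_injOn x (fun i hi => by simpa using hi) hx.injOn

lemma hammingNorm_extend_zero_le {κ : Type*} [Fintype κ] {x : ι → κ} (hx : Injective x)
    (c : ι → α) : hammingNorm (extend x c 0) ≤ hammingNorm c := by
  refine Finset.card_le_card_of_surjOn x fun z hz => ?_
  by_cases h : ∃ i, x i = z
  · obtain ⟨i, rfl⟩ := h
    exact ⟨i, by simpa [hx.extend_apply] using hz, rfl⟩
  · simp [extend_apply' _ _ _ h] at hz

variable [Fintype α] [DecidableEq ι]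

lemma card_filter_support_eq (s : Finset ι) :
    #{c : ι → α | ({i | c i ≠ 0} : Finset ι) = s} = (Fintype.card α - 1) ^ #s := by
  have hpi : ({c : ι → α | ({i | c i ≠ 0} : Finset ι) = s} : Finset (ι → α)) =
      Fintype.piFinset fun i => if i ∈ s then Finset.univ.erase 0 else {0} := by
    ext c
    simp only [Finset.mem_filter, Finset.mem_univ, true_and, Fintype.mem_piFinset, Finset.ext_iff]
    refine forall_congr' fun i => ?_
    by_cases hi : i ∈ s <;> simp [hi]
  simp [hpi, Fintype.card_piFinset, apply_ite Finset.card, Finset.prod_ite_mem]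

lemma card_filter_hammingNorm_eq (i : ℕ) :
    #{c : ι → α | hammingNorm c = i} =
      (Fintype.card ι).choose i * (Fintype.card α - 1) ^ i := by
  have hfiber (s : Finset ι) (hs : #s = i) :
      #{c ∈ ({c | hammingNorm c = i} : Finset (ι → α)) | ({j | c j ≠ 0} : Finset ι) = s} =
        (Fintype.card α - 1) ^ i := by
    rw [← hs, ← card_filter_support_eq s, Finset.filter_filter]
    congr! 2 with c
    exact and_iff_right_of_imp fun h => congrArg Finset.card h
  rw [Finset.card_eq_sum_card_fiberwise (f := fun c : ι → α => ({j | c j ≠ 0} : Finset ι))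
      (t := Finset.univ.powersetCard i) fun c hc => by simpa [hammingNorm] using hc,
    Finset.sum_congr rfl fun s hs => hfiber s (Finset.mem_powersetCard.1 hs).2]
  simp

lemma card_filter_hammingNorm_le (q : ℕ) :
    #{c : ι → α | hammingNorm c ≤ q} =
      ∑ i ∈ Finset.range (q + 1), (Fintype.card ι).choose i * (Fintype.card α - 1) ^ i := by
  rw [Finset.card_eq_sum_card_fiberwise (f := hammingNorm) (t := Finset.range (q + 1))
    fun c hc => by simpa [Nat.lt_succ_iff] using hc]
  refine Finset.sum_congr rfl fun i hi => ?_
  rw [← card_filter_hammingNorm_eq, Finset.filter_filter]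
  congr! 2 with c
  exact and_iff_right_of_imp fun h => h.trans_le (Finset.mem_range_succ_iff.1 hi)

end Hamming

section Characters

variable {H : Type*} [AddCommGroup H] [Fintype H]

lemma sum_addChar_mul_conj (ψ φ : AddChar H ℂ) :
    ∑ u, ψ u * starRingEnd ℂ (φ u) = if ψ = φ then (Fintype.card H : ℂ) else 0 := by
  simp_rw [← AddChar.map_neg_eq_conj, ← AddChar.sub_apply, AddChar.sum_eq_ite, sub_eq_zero]

lemma sum_norm_sq_sum_mul_addChar (S : Finset (AddChar H ℂ)) (a : AddChar H ℂ → ℂ) :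
    ∑ u, ‖∑ ψ ∈ S, a ψ * ψ u‖ ^ 2 = Fintype.card H * ∑ ψ ∈ S, ‖a ψ‖ ^ 2 := by
  apply Complex.ofReal_injective
  push_cast
  calc ∑ u, (‖∑ ψ ∈ S, a ψ * ψ u‖ : ℂ) ^ 2
      = ∑ u, ∑ ψ ∈ S, ∑ φ ∈ S,
          a ψ * starRingEnd ℂ (a φ) * (ψ u * starRingEnd ℂ (φ u)) := by
        simp_rw [← Complex.mul_conj', map_sum, map_mul, Finset.sum_mul_sum, mul_mul_mul_comm]
    _ = ∑ ψ ∈ S, ∑ φ ∈ S,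
          a ψ * starRingEnd ℂ (a φ) * ∑ u, ψ u * starRingEnd ℂ (φ u) := by
        rw [Finset.sum_comm]
        simp_rw [Finset.sum_comm (s := Finset.univ), Finset.mul_sum]
    _ = Fintype.card H * ∑ ψ ∈ S, (‖a ψ‖ : ℂ) ^ 2 := by
        simp +contextual [sum_addChar_mul_conj, Finset.mul_sum, Complex.mul_conj', mul_comm]

lemma norm_sq_apply_le_of_mem_span_addChar {S : Finset (AddChar H ℂ)} {f : H → ℂ}
    (hf : f ∈ Submodule.span ℂ ((⇑) '' (S : Set (AddChar H ℂ)))) (y : H) :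
    ‖f y‖ ^ 2 ≤ #S / Fintype.card H * ∑ u, ‖f u‖ ^ 2 := by
  obtain ⟨a, rfl⟩ : ∃ a : AddChar H ℂ → ℂ, (fun u => ∑ ψ ∈ S, a ψ * ψ u) = f := by
    obtain ⟨a, rfl⟩ := (Submodule.mem_span_image_finset_iff_exists_fun' ℂ).1 hf
    exact ⟨a, by ext u; simp⟩
  rw [sum_norm_sq_sum_mul_addChar, ← mul_assoc,
    div_mul_cancel₀ _ (Nat.cast_ne_zero.2 Fintype.card_ne_zero)]
  calc ‖∑ ψ ∈ S, a ψ * ψ y‖ ^ 2 ≤ (∑ ψ ∈ S, ‖a ψ‖) ^ 2 := by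
        gcongr
        simpa using norm_sum_le S fun ψ => a ψ * ψ y
    _ ≤ #S * ∑ ψ ∈ S, ‖a ψ‖ ^ 2 := sq_sum_le_card_mul_sum_sq

end Characters

section ProductCharacters

variable {ι κ G M : Type*} [Fintype ι] [Fintype κ] [AddCommGroup G] [CommMonoid M]

/-- The character `u ↦ ∏ i, c i (u i)` of the power `ι → G`. Every character of `ι → G` has this
form, and its degree as a function of the coordinates of `u` is `hammingNorm c`. -/
def piChar (c : ι → AddChar G M) : AddChar (ι → G) M where
  toFun u := ∏ i, c i (u i)
  map_zero_eq_one' := by simp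
  map_add_eq_mul' u v := by simp [AddChar.map_add_eq_mul, Finset.prod_mul_distrib]

lemma piChar_apply (c : ι → AddChar G M) (u : ι → G) : piChar c u = ∏ i, c i (u i) := rfl

lemma piChar_zero : piChar (0 : ι → AddChar G M) = 0 := by
  ext u
  simp [piChar_apply]

lemma piChar_add (c d : ι → AddChar G M) : piChar (c + d) = piChar c + piChar d := by
  ext u
  simp [piChar_apply, Finset.prod_mul_distrib]

lemma piChar_single [DecidableEq ι] (i : ι) (ξ : AddChar G M) (u : ι → G) :
    piChar (Pi.single i ξ) u = ξ (u i) := by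
  rw [piChar_apply, Finset.prod_eq_single i (fun j _ hj => by simp [hj]) (by simp),
    Pi.single_eq_same]

lemma piChar_apply_single [DecidableEq ι] (c : ι → AddChar G M) (i : ι) (g : G) :
    piChar c (Pi.single i g) = c i g := by
  rw [piChar_apply, Finset.prod_eq_single i (fun j _ hj => by simp [hj]) (by simp),
    Pi.single_eq_same]

lemma piChar_injective : Injective (piChar : (ι → AddChar G M) → AddChar (ι → G) M) := by
  classical
  intro c d h
  ext i g
  rw [← piChar_apply_single c, ← piChar_apply_single d, h]

lemma mul_piChar_update_zero [DecidableEq ι] (c : ι → AddChar G M) (i : ι) (u : ι → G) :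
    c i (u i) * piChar (update c i 0) u = piChar c u := by
  rw [← piChar_single i (c i) u, ← AddChar.add_apply, ← piChar_add]
  congr
  ext1 j
  rcases eq_or_ne j i with rfl | hj <;> simp [*]

lemma piChar_apply_extend {x : ι → κ} (hx : Injective x) (c : κ → AddChar G M) (u : ι → G) :
    piChar c (extend x u 0) = piChar (c ∘ x) u :=
  (Fintype.prod_of_injective x hx _ _
    (fun z hz => by rw [extend_apply' _ _ _ hz, Pi.zero_apply, AddChar.map_zero_eq_one])
    fun i => by rw [hx.extend_apply, comp_apply]).symm

lemma piChar_extend {x : ι → κ} (hx : Injective x) (c : ι → AddChar G M) (A : κ → G) :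
    piChar (extend x c 0) A = piChar c (A ∘ x) :=
  (Fintype.prod_of_injective x hx _ _
    (fun z hz => by rw [extend_apply' _ _ _ hz, Pi.zero_apply, AddChar.zero_apply])
    fun i => by rw [hx.extend_apply, comp_apply]).symm

end ProductCharacters

section LowDegree

variable {ι X G : Type*} [Fintype ι] [Fintype X] [AddCommGroup G]

variable (X G) in
/-- The functions of an oracle `A : X → G` of degree at most `q`, that is, the linear combinations
of products of characters of at most `q` values of `A`. -/
noncomputable def lowDegree (q : ℕ) : Submodule ℂ ((X → G) → ℂ) :=
  Submodule.span ℂ ((fun c => ⇑(piChar c)) '' {c : X → AddChar G ℂ | hammingNorm c ≤ q})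

lemma piChar_mem_lowDegree {q : ℕ} {c : X → AddChar G ℂ} (hc : hammingNorm c ≤ q) :
    ⇑(piChar c) ∈ lowDegree X G q :=
  Submodule.subset_span ⟨c, hc, rfl⟩

lemma const_mem_lowDegree_zero (a : ℂ) : (fun _ => a) ∈ lowDegree X G 0 := by
  convert! Submodule.smul_mem _ a (piChar_mem_lowDegree (G := G) (hammingNorm_zero (ι := X)).le)
  simp [piChar_zero]

lemma mul_mem_lowDegree {p q : ℕ} {f g : (X → G) → ℂ} (hf : f ∈ lowDegree X G p)
    (hg : g ∈ lowDegree X G q) : f * g ∈ lowDegree X G (p + q) := by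
  have hle : lowDegree X G p * lowDegree X G q ≤ lowDegree X G (p + q) := by
    rw [lowDegree, lowDegree, Submodule.span_mul_span, Submodule.span_le]
    rintro _ ⟨_, ⟨c, hc, rfl⟩, _, ⟨d, hd, rfl⟩, rfl⟩
    convert! piChar_mem_lowDegree ((hammingNorm_add_le c d).trans (add_le_add hc hd))
    rw [piChar_add]
    rfl
  exact hle (Submodule.mul_mem_mul hf hg)

lemma comp_add_extend_mem_lowDegree {q : ℕ} {f : (X → G) → ℂ} (hf : f ∈ lowDegree X G q)
    {x : ι → X} (hx : Injective x) (A : X → G) :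
    (fun u : ι → G => f (A + extend x u 0)) ∈ lowDegree ι G q := by
  have hle : lowDegree X G q ≤
      (lowDegree ι G q).comap (LinearMap.funLeft ℂ ℂ fun u : ι → G => A + extend x u 0) := by
    refine Submodule.span_le.2 ?_
    rintro _ ⟨c, hc, rfl⟩
    have hcomp : LinearMap.funLeft ℂ ℂ (fun u : ι → G => A + extend x u 0) (piChar c) =
        piChar c A • ⇑(piChar (c ∘ x)) := by
      ext u
      simp [LinearMap.funLeft_apply, AddChar.map_add_eq_mul, piChar_apply_extend hx]
    rw [SetLike.mem_coe, Submodule.mem_comap, hcomp]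
    exact Submodule.smul_mem _ _ (piChar_mem_lowDegree ((hammingNorm_comp_le hx c).trans hc))
  exact hle hf

variable [Fintype G] [DecidableEq ι]

variable (ι G) in
/-- The proportion of characters of `ι → G` of degree at most `q`. -/
noncomputable def lowDegreeRatio (q : ℕ) : ℝ :=
  #{c : ι → AddChar G ℂ | hammingNorm c ≤ q} / Fintype.card (ι → G)

lemma lowDegreeRatio_eq (q : ℕ) :
    lowDegreeRatio ι G q = 1 / (Fintype.card G : ℝ) ^ Fintype.card ι *
      ∑ i ∈ Finset.range (q + 1),
        ((Fintype.card ι).choose i : ℝ) * ((Fintype.card G : ℝ) - 1) ^ i := by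
  rw [lowDegreeRatio, card_filter_hammingNorm_le, AddChar.card_eq, Fintype.card_fun,
    div_eq_inv_mul, one_div]
  simp [Nat.cast_pred Fintype.card_pos]

lemma norm_sq_apply_le_of_mem_lowDegree {q : ℕ} {f : (ι → G) → ℂ} (hf : f ∈ lowDegree ι G q)
    (y : ι → G) : ‖f y‖ ^ 2 ≤ lowDegreeRatio ι G q * ∑ u, ‖f u‖ ^ 2 := by
  set S : Finset (AddChar (ι → G) ℂ) := Finset.image piChar {c | hammingNorm c ≤ q} with hS
  have hcard : #S = #{c : ι → AddChar G ℂ | hammingNorm c ≤ q} :=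
    Finset.card_image_of_injective _ piChar_injective
  have hfS : f ∈ Submodule.span ℂ ((⇑) '' (S : Set (AddChar (ι → G) ℂ))) := by
    simpa [hS, lowDegree, Set.image_image] using hf
  simpa only [lowDegreeRatio, hcard] using norm_sq_apply_le_of_mem_span_addChar hfS y

lemma sum_fiber_sum_add_extend {M : Type*} [AddCommMonoid M] [DecidableEq X] [DecidableEq G]
    {x : ι → X} (hx : Injective x) (y : ι → G) (F : (X → G) → M) :
    ∑ A with A ∘ x = y, ∑ u : ι → G, F (A + extend x u 0) = ∑ A, F A := by
  rw [Finset.sum_comm, ← Finset.sum_fiberwise Finset.univ (fun A => A ∘ x - y) F]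
  refine Finset.sum_congr rfl fun u _ =>
    Finset.sum_equiv (Equiv.addRight (extend x u 0)) (fun A => ?_) fun _ _ => rfl
  have hcomp : (A + extend x u 0) ∘ x = A ∘ x + u := by
    ext i
    simp [hx.extend_apply]
  simp [hcomp, add_sub_right_comm, sub_eq_zero]

lemma sum_norm_sq_fiber_le_of_mem_lowDegree [DecidableEq X] [DecidableEq G] {q : ℕ}
    {f : (X → G) → ℂ} (hf : f ∈ lowDegree X G q) {x : ι → X} (hx : Injective x) (y : ι → G) :
    ∑ A with A ∘ x = y, ‖f A‖ ^ 2 ≤ lowDegreeRatio ι G q * ∑ A, ‖f A‖ ^ 2 := by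
  classical
  -- Varying `A` on the range of `x` only makes `f` a low-degree function of `ι → G`.
  rw [← sum_fiber_sum_add_extend hx y, Finset.mul_sum]
  refine Finset.sum_le_sum fun A _ => ?_
  have hzero : A + extend x (0 : ι → G) 0 = A := by
    ext z
    by_cases h : ∃ i, x i = z
    · obtain ⟨i, rfl⟩ := h
      simp [hx.extend_apply]
    · simp [extend_apply' _ _ _ h]
  simpa [hzero] using
    norm_sq_apply_le_of_mem_lowDegree (comp_add_extend_mem_lowDegree hf hx A) 0

lemma sum_norm_sq_isInterrogation_le [DecidableEq X] {q k : ℕ}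
    {f : (X → G) → ℂ} (hf : f ∈ lowDegree X G q) (y : Fin k → X × G)
    [DecidablePred fun A : X → G => IsInterrogation A y] :
    ∑ A with IsInterrogation A y, ‖f A‖ ^ 2 ≤ lowDegreeRatio (Fin k) G q * ∑ A, ‖f A‖ ^ 2 := by
  classical
  by_cases hinj : Injective fun i => (y i).1
  · simpa [IsInterrogation, hinj, funext_iff] using
      sum_norm_sq_fiber_le_of_mem_lowDegree hf hinj fun i => (y i).2
  · have hR : 0 ≤ lowDegreeRatio (Fin k) G q := by unfold lowDegreeRatio; positivity
    simp only [IsInterrogation, hinj, false_and, Finset.filter_false, Finset.sum_empty]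
    positivity

end LowDegree

section Preparation

variable {Ω B : Type*} [Fintype B] [DecidableEq B] {O D : Ω → Matrix B B ℂ} {q : ℕ}
  {ψ : Ω → B → ℂ}

lemma sum_norm_sq_unitary_mulVec {U : Matrix B B ℂ} (hU : U ∈ Matrix.unitaryGroup B ℂ)
    (v : B → ℂ) : ∑ b, ‖(U *ᵥ v) b‖ ^ 2 = ∑ b, ‖v b‖ ^ 2 := by
  have hsum (w : B → ℂ) : ((∑ b, ‖w b‖ ^ 2 : ℝ) : ℂ) = star w ⬝ᵥ w := by
    simp [dotProduct, Complex.conj_mul']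
  apply Complex.ofReal_injective
  rw [hsum, hsum, Matrix.star_mulVec, Matrix.dotProduct_mulVec, Matrix.vecMul_vecMul,
    ← Matrix.star_eq_conjTranspose, Matrix.mem_unitaryGroup_iff'.1 hU, Matrix.vecMul_one]

/-- `IsPreparable O q ψ` says that the family of states `ψ A`, indexed by the oracles `A`, is
obtained from a unit vector not depending on `A` by `q` applications of the query operator `O A`,
each followed by a unitary not depending on `A`. -/
inductive IsPreparable (O : Ω → Matrix B B ℂ) : ℕ → (Ω → B → ℂ) → Prop
  | init {v : B → ℂ} (hv : ∑ b, ‖v b‖ ^ 2 = 1) : IsPreparable O 0 fun _ => v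
  | query {q : ℕ} {ψ : Ω → B → ℂ} (hψ : IsPreparable O q ψ) (U : Matrix.unitaryGroup B ℂ) :
      IsPreparable O (q + 1) fun A => U *ᵥ (O A *ᵥ ψ A)

lemma isPreparable_runQueries {v : B → ℂ} (hv : ∑ b, ‖v b‖ ^ 2 = 1) :
    ∀ {q : ℕ} (U : Fin q → Matrix.unitaryGroup B ℂ),
      IsPreparable O q fun A => runQueries (O A) U v
  | 0, _ => .init hv
  | _ + 1, U => .query (isPreparable_runQueries hv fun i => U i.castSucc) (U (Fin.last _))

namespace IsPreparable

lemma exists_runQueries (hψ : IsPreparable O q ψ) :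
    ∃ (U : Fin q → Matrix.unitaryGroup B ℂ) (v : B → ℂ),
      ∑ b, ‖v b‖ ^ 2 = 1 ∧ ∀ A, runQueries (O A) U v = ψ A := by
  induction hψ with
  | init hv => exact ⟨Fin.elim0, _, hv, fun A => rfl⟩
  | query _ U ih =>
    obtain ⟨V, v, hv, hV⟩ := ih
    exact ⟨Fin.snoc V U, v, hv, fun A => by simp [runQueries, hV]⟩

lemma mulVec (hψ : IsPreparable O q ψ) (U : Matrix.unitaryGroup B ℂ) :
    IsPreparable O q fun A => U *ᵥ ψ A := by
  cases hψ with
  | init hv => exact .init ((sum_norm_sq_unitary_mulVec U.2 _).trans hv)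
  | query hφ V =>
    simpa only [Matrix.mulVec_mulVec, Submonoid.coe_mul, Matrix.mul_assoc] using hφ.query (U * V)

lemma of_semiconjBy {V : Matrix.unitaryGroup B ℂ}
    (hV : ∀ A, SemiconjBy (V : Matrix B B ℂ) (D A) (O A)) (hψ : IsPreparable D q ψ) :
    IsPreparable O q ψ := by
  suffices h : IsPreparable O q fun A => V *ᵥ ψ A by simpa using h.mulVec V⁻¹
  induction hψ with
  | init hv => exact .init ((sum_norm_sq_unitary_mulVec V.2 _).trans hv)
  | @query _ φ _ U ih =>
    have hconj (A : Ω) : ((V * U * V⁻¹ : Matrix.unitaryGroup B ℂ) : Matrix B B ℂ) *ᵥ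
        (O A *ᵥ ((V : Matrix B B ℂ) *ᵥ φ A)) = (V : Matrix B B ℂ) *ᵥ (U *ᵥ (D A *ᵥ φ A)) := by
      rw [Matrix.mulVec_mulVec (φ A), ← (hV A).eq]
      simp only [Matrix.mulVec_mulVec, Matrix.UnitaryGroup.mul_val, Matrix.UnitaryGroup.inv_val,
        Matrix.mul_assoc, ← Matrix.mul_assoc (star _), Unitary.coe_star_mul_self, one_mul]
    simpa only [hconj] using ih.query (V * U * V⁻¹)

lemma sum_norm_sq (hψ : IsPreparable O q ψ) (hO : ∀ A, O A ∈ Matrix.unitaryGroup B ℂ) (A : Ω) :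
    ∑ b, ‖ψ A b‖ ^ 2 = 1 := by
  induction hψ with
  | init hv => exact hv
  | query _ U ih => rw [sum_norm_sq_unitary_mulVec U.2, sum_norm_sq_unitary_mulVec (hO A), ih]

lemma mem_lowDegree {X G : Type*} [Fintype X] [AddCommGroup G]
    {O : (X → G) → Matrix B B ℂ} {ψ : (X → G) → B → ℂ} (hψ : IsPreparable O q ψ)
    (hO : ∀ b' b, (fun A => O A b' b) ∈ lowDegree X G 1) (b : B) :
    (fun A => ψ A b) ∈ lowDegree X G q := by
  induction hψ generalizing b with
  | init => exact const_mem_lowDegree_zero _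
  | @query q φ _ U ih =>
    have hquery (c : B) : (fun A => (O A *ᵥ φ A) c) ∈ lowDegree X G (q + 1) := by
      have hsum : (fun A => (O A *ᵥ φ A) c) = ∑ b, (fun A => O A c b) * fun A => φ A b := by
        ext A
        simp [Matrix.mulVec, dotProduct]
      rw [hsum, add_comm]
      exact Submodule.sum_mem _ fun b _ => mul_mem_lowDegree (hO c b) (ih b)
    have hstep : (fun A => ((U : Matrix B B ℂ) *ᵥ (O A *ᵥ φ A)) b) =
        ∑ c, (U : Matrix B B ℂ) b c • fun A => (O A *ᵥ φ A) c := by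
      ext A
      simp [Matrix.mulVec, dotProduct]
    rw [hstep]
    exact Submodule.sum_mem _ fun c _ => Submodule.smul_mem _ _ (hquery c)

end IsPreparable

lemma isPreparable_congr {V : Matrix.unitaryGroup B ℂ}
    (hV : ∀ A, SemiconjBy (V : Matrix B B ℂ) (D A) (O A)) :
    IsPreparable O q ψ ↔ IsPreparable D q ψ :=
  ⟨.of_semiconjBy (V := V⁻¹) fun A =>
    SemiconjBy.units_inv_symm_left (a := Unitary.toUnits V) (hV A), .of_semiconjBy hV⟩

end Preparation

section PhaseModel

variable {X R G Z : Type*} [DecidableEq X] [DecidableEq R] [AddCommGroup G] [DecidableEq Z]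

/-- The phase query in which the basis state `r` of the response register stands for the character
`σ r` of `G`. -/
noncomputable def labelledPhaseQuery (σ : R → AddChar G ℂ) (A : X → G) :
    Matrix (X × R × Z) (X × R × Z) ℂ :=
  Matrix.diagonal fun b => σ b.2.1 (A b.1)

variable [Fintype X]

lemma labelledPhaseQuery_mem_lowDegree (σ : R → AddChar G ℂ) (b' b : X × R × Z) :
    (fun A : X → G => labelledPhaseQuery σ A b' b) ∈ lowDegree X G 1 := by
  rcases eq_or_ne b' b with rfl | hb
  · simpa only [labelledPhaseQuery, Matrix.diagonal_apply_eq, ← piChar_single] using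
      piChar_mem_lowDegree (hammingNorm_single_le b'.1 (σ b'.2.1))
  · simp only [labelledPhaseQuery, Matrix.diagonal_apply_ne _ hb]
    exact Submodule.zero_mem _

variable [Fintype R] [Fintype Z]

/-- A query model is a phase model if a unitary not depending on the oracle turns it into a phase
query in which every character of `G` is available. -/
def IsPhaseModel (query : (w : ℕ) → (X → G) → Matrix (X × R × Fin w) (X × R × Fin w) ℂ) : Prop :=
  ∃ σ : R → AddChar G ℂ, Surjective σ ∧
    ∀ w, ∃ V : Matrix.unitaryGroup (X × R × Fin w) ℂ, ∀ A,
      SemiconjBy (V : Matrix (X × R × Fin w) (X × R × Fin w) ℂ) (labelledPhaseQuery σ A)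
        (query w A)

lemma labelledPhaseQuery_mulVec (σ : R → AddChar G ℂ) (A : X → G) (v : X × R × Z → ℂ)
    (b : X × R × Z) : (labelledPhaseQuery σ A *ᵥ v) b = σ b.2.1 (A b.1) * v b :=
  Matrix.mulVec_diagonal _ _ _

variable [Finite G]

lemma labelledPhaseQuery_mem_unitaryGroup (σ : R → AddChar G ℂ) (A : X → G) :
    (labelledPhaseQuery σ A : Matrix (X × R × Z) (X × R × Z) ℂ) ∈ Matrix.unitaryGroup _ ℂ := by
  simp [Matrix.mem_unitaryGroup_iff, labelledPhaseQuery, Matrix.star_eq_conjTranspose,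
    Complex.mul_conj']

end PhaseModel

section UpperBound

variable {X R G : Type*} [Fintype X] [DecidableEq X] [Fintype R] [DecidableEq R] [AddCommGroup G]
  [Fintype G]

lemma successProb_le {query : (w : ℕ) → (X → G) → Matrix (X × R × Fin w) (X × R × Fin w) ℂ}
    (hquery : IsPhaseModel query) {q k : ℕ} (alg : QueryAlgorithm X R (Fin k → X × G) q) :
    successProb query alg ≤ lowDegreeRatio (Fin k) G q := by
  classical
  obtain ⟨σ, -, hV⟩ := hquery
  obtain ⟨V, hV⟩ := hV alg.w
  set ψ : (X → G) → X × R × Fin alg.w → ℂ := fun A =>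
    runQueries (query alg.w A) alg.step alg.init with hψ
  have hprep : IsPreparable (labelledPhaseQuery σ) q ψ :=
    (isPreparable_congr hV).1 (isPreparable_runQueries alg.init_unit alg.step)
  have hdeg (b) : (fun A => ψ A b) ∈ lowDegree X G q :=
    hprep.mem_lowDegree (labelledPhaseQuery_mem_lowDegree σ) b
  have hnorm (A) : ∑ b, ‖ψ A b‖ ^ 2 = 1 :=
    hprep.sum_norm_sq (labelledPhaseQuery_mem_unitaryGroup σ) A
  rw [successProb, div_le_iff₀ (Nat.cast_pos.2 Fintype.card_pos)]
  calc ∑ A, successProbOn query alg A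
      = ∑ b, ∑ A with IsInterrogation A (alg.out b), ‖ψ A b‖ ^ 2 := by
        simp only [successProbOn, Finset.sum_filter, hψ]
        exact Finset.sum_comm
    _ ≤ ∑ b, lowDegreeRatio (Fin k) G q * ∑ A, ‖ψ A b‖ ^ 2 :=
        Finset.sum_le_sum fun b _ => sum_norm_sq_isInterrogation_le (hdeg b) (alg.out b)
    _ = lowDegreeRatio (Fin k) G q * Fintype.card (X → G) := by
        rw [← Finset.mul_sum, Finset.sum_comm]
        simp [hnorm]

end UpperBound

section Fourier

variable {B H : Type*} [AddCommGroup H] [Fintype H]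

/-- The inverse Fourier transform of `H`, on a register whose basis state `b` stands both for the
element `e b` of `H` and for the character `χ b`. -/
noncomputable def fourierMatrix (e : B ≃ H) (χ : B → AddChar H ℂ) : Matrix B B ℂ :=
  Matrix.of fun b c => (√(Fintype.card H) : ℂ)⁻¹ * starRingEnd ℂ (χ c (e b))

variable [Fintype B] {e : B ≃ H} {χ : B → AddChar H ℂ}

lemma fourierMatrix_mem_unitaryGroup [DecidableEq B] (hχ : Injective χ) :
    fourierMatrix e χ ∈ Matrix.unitaryGroup B ℂ := by
  rw [Matrix.mem_unitaryGroup_iff']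
  ext c d
  have hsqrt : (√(Fintype.card H) : ℂ) * √(Fintype.card H) = Fintype.card H := by
    exact_mod_cast Real.mul_self_sqrt (Nat.cast_nonneg (Fintype.card H))
  calc (star (fourierMatrix e χ) * fourierMatrix e χ) c d
      = (Fintype.card H : ℂ)⁻¹ * ∑ b, χ c (e b) * starRingEnd ℂ (χ d (e b)) := by
        simp only [Matrix.mul_apply, Matrix.star_apply, fourierMatrix, Matrix.of_apply, ← hsqrt,
          Finset.mul_sum, RCLike.star_def, map_mul, map_inv₀, Complex.conj_ofReal,
          Complex.conj_conj, mul_inv]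
        exact Finset.sum_congr rfl fun b _ => by ring
    _ = (1 : Matrix B B ℂ) c d := by
        rw [e.sum_comp fun u => χ c u * starRingEnd ℂ (χ d u), sum_addChar_mul_conj]
        simp [Matrix.one_apply, hχ.eq_iff]

lemma fourierMatrix_mulVec_apply [DecidableEq B] (S : Finset B) (a : ℂ) (h : H) :
    (fourierMatrix e χ *ᵥ fun b => (if b ∈ S then a else 0) * χ b h) (e.symm h) =
      #S * a / √(Fintype.card H) := by
  have hterm (b : B) : (√(Fintype.card H) : ℂ)⁻¹ * starRingEnd ℂ (χ b h) *
      ((if b ∈ S then a else 0) * χ b h) = if b ∈ S then a / √(Fintype.card H) else 0 := by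
    have hunit : starRingEnd ℂ (χ b h) * χ b h = 1 := by simp [Complex.conj_mul']
    split_ifs
    · linear_combination (√(Fintype.card H) : ℂ)⁻¹ * a * hunit
    · ring
  simp only [fourierMatrix, Matrix.mulVec, dotProduct, Matrix.of_apply, Equiv.apply_symm_apply,
    hterm]
  simp [mul_div_assoc]

end Fourier

section ControlledState

variable {X R Z : Type*} [DecidableEq X] [DecidableEq R]

/-- The state `∑ z, a z • |p z, z⟩`, in which the query and response registers are determined by
the workspace register. -/
def controlledState (p : Z → X × R) (a : Z → ℂ) (b : X × R × Z) : ℂ :=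
  if (b.1, b.2.1) = p b.2.2 then a b.2.2 else 0

variable [Fintype X] [Fintype R] [Fintype Z]

lemma sum_norm_sq_controlledState (p : Z → X × R) (a : Z → ℂ) :
    ∑ b, ‖controlledState p a b‖ ^ 2 = ∑ z, ‖a z‖ ^ 2 := by
  rw [← (Equiv.prodAssoc X R Z).sum_comp, Fintype.sum_prod_type_right]
  simp [controlledState, apply_ite]

variable [DecidableEq Z]

lemma labelledPhaseQuery_mulVec_controlledState {G : Type*} [AddCommGroup G]
    (σ : R → AddChar G ℂ) (A : X → G) (p : Z → X × R) (a : Z → ℂ) :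
    labelledPhaseQuery σ A *ᵥ controlledState p a =
      controlledState p fun z => σ (p z).2 (A (p z).1) * a z := by
  ext ⟨x, r, z⟩
  rw [labelledPhaseQuery_mulVec]
  by_cases hp : (x, r) = p z
  · simp [controlledState, ← hp]
  · simp [controlledState, hp]

lemma permMatrix_mem_unitaryGroup {B : Type*} [Fintype B] [DecidableEq B] (π : Equiv.Perm B) :
    π.permMatrix ℂ ∈ Matrix.unitaryGroup B ℂ := by
  rw [Matrix.mem_unitaryGroup_iff, Matrix.star_eq_conjTranspose, Matrix.conjTranspose_permMatrix,
    ← Matrix.permMatrix_mul, inv_mul_cancel, Matrix.permMatrix_one]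

lemma exists_mulVec_controlledState_eq (p p' : Z → X × R) :
    ∃ U : Matrix.unitaryGroup (X × R × Z) ℂ,
      ∀ a, U *ᵥ controlledState p a = controlledState p' a := by
  refine ⟨⟨_, permMatrix_mem_unitaryGroup ((Equiv.prodAssoc X R Z).permCongr
    (Equiv.prodCongrLeft fun z => Equiv.swap (p z) (p' z)))⟩, fun a => ?_⟩
  ext ⟨x, r, z⟩
  simp [Matrix.permMatrix_mulVec, controlledState, Equiv.swap_apply_eq_iff]

lemma isPreparable_piChar [Nonempty X] {G : Type*} [AddCommGroup G] {σ : R → AddChar G ℂ}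
    (hσ : Surjective σ) {a : Z → ℂ} (ha : ∑ z, ‖a z‖ ^ 2 = 1) {n : ℕ} {c : Z → X → AddChar G ℂ}
    (hc : ∀ z, a z ≠ 0 → hammingNorm (c z) ≤ n) (p : Z → X × R) :
    IsPreparable (labelledPhaseQuery σ) n fun A =>
      controlledState p fun z => a z * piChar (c z) A := by
  induction n generalizing c p with
  | zero =>
    have hconst (A : X → G) (z : Z) : a z * piChar (c z) A = a z := by
      by_cases hz : a z = 0
      · simp [hz]
      · simp [hammingNorm_eq_zero.1 (Nat.le_zero.1 (hc z hz)), piChar_zero]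
    simpa only [hconst] using .init ((sum_norm_sq_controlledState p a).trans ha)
  | succ n ih =>
    -- The workspace register selects a query that supplies one nontrivial factor of `c z`.
    choose x hx using fun z => exists_hammingNorm_update_zero_le (c z)
    choose r hr using fun z => hσ (c z (x z))
    obtain ⟨U, hU⟩ := exists_mulVec_controlledState_eq (fun z => (x z, r z)) p
    have hlower (z : Z) (hz : a z ≠ 0) : hammingNorm (update (c z) (x z) 0) ≤ n :=
      (hx z).trans (Nat.sub_le_of_le_add (hc z hz))
    have hmul (A : X → G) (z : Z) : σ (r z) (A (x z)) *
        (a z * piChar (update (c z) (x z) 0) A) = a z * piChar (c z) A := by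
      rw [hr, mul_left_comm, mul_piChar_update_zero]
    simpa only [labelledPhaseQuery_mulVec_controlledState, hU, hmul] using
      (ih hlower fun z => (x z, r z)).query U

end ControlledState

lemma one_kronecker_mulVec_apply {m n α : Type*} [Fintype m] [DecidableEq m] [Fintype n]
    [NonAssocSemiring α] (M : Matrix n n α) (v : m × n → α) (i : m) (j : n) :
    (((1 : Matrix m m α) ⊗ₖ M) *ᵥ v) (i, j) = (M *ᵥ fun j' => v (i, j')) j := by
  simp [Matrix.mulVec, dotProduct, Fintype.sum_prod_type, Matrix.one_apply]

lemma norm_sq_runQueries_le_successProbOn {X R G : Type*} [Fintype X] [DecidableEq X] [Fintype R]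
    [DecidableEq R] {query : (w : ℕ) → (X → G) → Matrix (X × R × Fin w) (X × R × Fin w) ℂ}
    {q k : ℕ} {alg : QueryAlgorithm X R (Fin k → X × G) q} {A : X → G} {b : X × R × Fin alg.w}
    (hb : IsInterrogation A (alg.out b)) :
    ‖runQueries (query alg.w A) alg.step alg.init b‖ ^ 2 ≤ successProbOn query alg A := by
  rw [successProbOn, ← Finset.sum_filter]
  exact Finset.single_le_sum (f := fun b => ‖runQueries (query alg.w A) alg.step alg.init b‖ ^ 2)
    (fun _ _ => by positivity) (by simpa using hb)

section LowerBound

variable {X R G : Type*} [Fintype X] [DecidableEq X] [Fintype R] [DecidableEq R] [AddCommGroup G]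
  [Fintype G] [Nonempty X]

lemma exists_isPreparable_norm_sq_eq_card_div {ι Z : Type*} [Fintype ι]
    [DecidableEq ι] [Fintype Z] [DecidableEq Z] {σ : R → AddChar G ℂ} (hσ : Surjective σ)
    {x : ι → X} (hx : Injective x) (e : Z ≃ (ι → G)) {d : Z → ι → AddChar G ℂ} (hd : Injective d)
    {S : Finset Z} (hS : S.Nonempty) {q : ℕ} (hSq : ∀ z ∈ S, hammingNorm (d z) ≤ q) :
    ∃ (s : X × R) (ψ : (X → G) → X × R × Z → ℂ), IsPreparable (labelledPhaseQuery σ) q ψ ∧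
      ∀ A, ‖ψ A (s.1, s.2, e.symm (A ∘ x))‖ ^ 2 = #S / Fintype.card (ι → G) := by
  obtain ⟨r, -⟩ := hσ 0
  let s : X × R := (Classical.arbitrary X, r)
  let a : Z → ℂ := fun z => if z ∈ S then (√(#S) : ℂ)⁻¹ else 0
  have hunit : ∑ z, ‖a z‖ ^ 2 = 1 := by
    simp [a, apply_ite, ite_pow, hS.card_ne_zero]
  have hweight (z : Z) (hz : a z ≠ 0) : hammingNorm (extend x (d z) 0) ≤ q :=
    (hammingNorm_extend_zero_le hx _).trans (hSq z (by_contra fun h => hz (if_neg h)))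
  let F : Matrix.unitaryGroup (X × R × Z) ℂ :=
    ⟨1 ⊗ₖ (1 ⊗ₖ fourierMatrix e (piChar ∘ d)), Matrix.kronecker_mem_unitary (one_mem _)
      (Matrix.kronecker_mem_unitary (one_mem _)
        (fourierMatrix_mem_unitaryGroup (piChar_injective.comp hd)))⟩
  refine ⟨s, _, (isPreparable_piChar hσ hunit hweight fun _ => s).mulVec F, fun A => ?_⟩
  have hamp : ((F : Matrix (X × R × Z) (X × R × Z) ℂ) *ᵥ controlledState (fun _ => s) fun z =>
      a z * piChar (extend x (d z) 0) A) (s.1, s.2, e.symm (A ∘ x)) =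
        #S * (√(#S) : ℂ)⁻¹ / √(Fintype.card (ι → G)) := by
    rw [one_kronecker_mulVec_apply, one_kronecker_mulVec_apply]
    simp only [controlledState, if_true, piChar_extend hx]
    exact fourierMatrix_mulVec_apply S _ _
  simp only [hamp, norm_div, norm_mul, norm_inv, Complex.norm_natCast, Complex.norm_real,
    Real.norm_eq_abs, div_pow, mul_pow, inv_pow, sq_abs, Real.sq_sqrt (Nat.cast_nonneg _)]
  field_simp

lemma exists_isPreparable_norm_sq_eq_lowDegreeRatio {ι Z : Type*} [Fintype ι] [DecidableEq ι]
    [Fintype Z] [DecidableEq Z] {σ : R → AddChar G ℂ} (hσ : Surjective σ) {x : ι → X}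
    (hx : Injective x) (e : Z ≃ (ι → G)) (q : ℕ) :
    ∃ (s : X × R) (ψ : (X → G) → X × R × Z → ℂ), IsPreparable (labelledPhaseQuery σ) q ψ ∧
      ∀ A, ‖ψ A (s.1, s.2, e.symm (A ∘ x))‖ ^ 2 = lowDegreeRatio ι G q := by
  let d : Z ≃ (ι → AddChar G ℂ) := e.trans (Fintype.equivOfCardEq (by simp [AddChar.card_eq]))
  let S : Finset Z := {z | hammingNorm (d z) ≤ q}
  have hcard : #S = #{c : ι → AddChar G ℂ | hammingNorm c ≤ q} :=
    Finset.card_equiv d fun z => by simp [S]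
  rw [lowDegreeRatio, ← hcard]
  exact exists_isPreparable_norm_sq_eq_card_div hσ hx e d.injective ⟨d.symm 0, by simp [S]⟩
    fun z hz => (Finset.mem_filter.1 hz).2

lemma exists_lowDegreeRatio_le_successProb
    {query : (w : ℕ) → (X → G) → Matrix (X × R × Fin w) (X × R × Fin w) ℂ}
    (hquery : IsPhaseModel query) (q : ℕ) {k : ℕ} (hk : k ≤ Fintype.card X) :
    ∃ alg : QueryAlgorithm X R (Fin k → X × G) q,
      lowDegreeRatio (Fin k) G q ≤ successProb query alg := by
  classical
  obtain ⟨σ, hσ, hV⟩ := hquery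
  obtain ⟨V, hV⟩ := hV (Fintype.card (Fin k → G))
  let e := (Fintype.equivFin (Fin k → G)).symm
  obtain ⟨x⟩ : Nonempty (Fin k ↪ X) := Embedding.nonempty_of_card_le (by simpa using hk)
  obtain ⟨s, ψ, hprep, hψ⟩ :=
    exists_isPreparable_norm_sq_eq_lowDegreeRatio hσ x.injective e q
  obtain ⟨U, v, hv, hrun⟩ := ((isPreparable_congr hV).2 hprep).exists_runQueries
  let alg : QueryAlgorithm X R (Fin k → X × G) q := ⟨_, v, hv, U, fun b i => (x i, e b.2.2 i)⟩
  have hfixed (A : X → G) : lowDegreeRatio (Fin k) G q ≤ successProbOn query alg A := by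
    rw [← hψ A, ← hrun A]
    exact norm_sq_runQueries_le_successProbOn (alg := alg) ⟨x.injective, fun i => by simp [alg]⟩
  refine ⟨alg, ?_⟩
  rw [successProb, le_div_iff₀ (Nat.cast_pos.2 Fintype.card_pos), mul_comm, ← nsmul_eq_mul]
  exact Finset.card_nsmul_le_sum _ _ _ fun A _ => hfixed A

end LowerBound

section QueryModels

variable {X G : Type*} [Fintype X] [DecidableEq X] [AddCommGroup G]

lemma isPhaseModel_phaseQuery [Finite G] :
    IsPhaseModel (phaseQuery : (w : ℕ) → (X → G) → Matrix (X × AddChar G ℂ × Fin w) _ ℂ) :=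
  ⟨id, surjective_id, fun _ => ⟨1, fun _ => SemiconjBy.one_left _⟩⟩

variable [Fintype G] [DecidableEq G]

lemma addQuery_mul_apply (w : ℕ) (A : X → G) (M : Matrix (X × G × Fin w) (X × G × Fin w) ℂ)
    (x : X) (g : G) (z : Fin w) (b : X × G × Fin w) :
    (addQuery w A * M) (x, g, z) b = M (x, g - A x, z) b := by
  have hpreimage (c : X × G × Fin w) :
      (x, g, z) = (c.1, c.2.1 + A c.1, c.2.2) ↔ c = (x, g - A x, z) := by
    constructor
    · rintro ⟨⟩
      simp
    · rintro rfl
      simp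
  simp [Matrix.mul_apply, addQuery, hpreimage]

lemma isPhaseModel_addQuery :
    IsPhaseModel (addQuery : (w : ℕ) → (X → G) → Matrix (X × G × Fin w) _ ℂ) := by
  let σ : G ≃ AddChar G ℂ := Fintype.equivOfCardEq AddChar.card_eq.symm
  refine ⟨σ, σ.surjective, fun w => ⟨⟨1 ⊗ₖ (fourierMatrix (Equiv.refl G) σ ⊗ₖ 1),
    Matrix.kronecker_mem_unitary (one_mem _) (Matrix.kronecker_mem_unitary
      (fourierMatrix_mem_unitaryGroup σ.injective) (one_mem _))⟩, fun A => ?_⟩⟩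
  ext ⟨x, g, z⟩ ⟨y, r, t⟩
  rw [addQuery_mul_apply, labelledPhaseQuery, Matrix.mul_diagonal]
  rcases eq_or_ne x y with rfl | hxy
  · simp [fourierMatrix, sub_eq_add_neg, AddChar.map_add_eq_mul, AddChar.map_neg_eq_conj]
    ring
  · simp [hxy]

end QueryModels

theorem theorem5p2_general {X R G : Type*} [Fintype X] [DecidableEq X] [Nonempty X] [Fintype R]
    [DecidableEq R] [AddCommGroup G] [Fintype G]
    {query : (w : ℕ) → (X → G) → Matrix (X × R × Fin w) (X × R × Fin w) ℂ}
    (hquery : IsPhaseModel query) (q k : ℕ) (hk : k ≤ Fintype.card X) :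
    IsGreatest
      {p : ℝ | ∃ alg : QueryAlgorithm X R (Fin k → X × G) q, successProb query alg = p}
      (1 / (Fintype.card G : ℝ) ^ k *
        ∑ i ∈ Finset.range (q + 1), (k.choose i : ℝ) * ((Fintype.card G : ℝ) - 1) ^ i) := by
  have hratio := lowDegreeRatio_eq (ι := Fin k) (G := G) q
  rw [Fintype.card_fin] at hratio
  rw [← hratio]
  obtain ⟨alg, halg⟩ := exists_lowDegreeRatio_le_successProb hquery q hk
  refine ⟨⟨alg, (successProb_le hquery alg).antisymm halg⟩, ?_⟩
  rintro _ ⟨alg', rfl⟩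
  exact successProb_le hquery alg'

/-- Oracle interrogation: the maximum success probability of `q`-query quantum algorithms, both
with controlled-add queries and with phase queries. -/
theorem theorem5p2 {X G : Type*} [Fintype X] [DecidableEq X] [AddCommGroup G] [Fintype G]
    [DecidableEq G] (q k : ℕ) (hqk : q < k) (hk : k ≤ Fintype.card X) :
    IsGreatest
      {p : ℝ | ∃ alg : QueryAlgorithm X G (Fin k → X × G) q, successProb addQuery alg = p}
      (1 / (Fintype.card G : ℝ) ^ k *
        ∑ i ∈ Finset.range (q + 1), (k.choose i : ℝ) * ((Fintype.card G : ℝ) - 1) ^ i) ∧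
    IsGreatest
      {p : ℝ | ∃ alg : QueryAlgorithm X (AddChar G ℂ) (Fin k → X × G) q,
        successProb phaseQuery alg = p}
      (1 / (Fintype.card G : ℝ) ^ k *
        ∑ i ∈ Finset.range (q + 1), (k.choose i : ℝ) * ((Fintype.card G : ℝ) - 1) ^ i) := by
  have : Nonempty X := Fintype.card_pos_iff.1 (q.zero_le.trans_lt (hqk.trans_le hk))
  exact ⟨theorem5p2_general isPhaseModel_addQuery q k hk,
    theorem5p2_general isPhaseModel_phaseQuery q k hk⟩
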